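/- \textbf{Theorem (Barr's Theorem).} Let $\mathcal{E}$ be a Grothendieck topos, i.e. a category equivalent to the category $Sh(C,J)$ of sheaves of sets on a small site $(C,J)$. Then there exist a complete Boolean algebra $B$ and a surjective geometric morphism $f : Sh(B) \to \mathcal{E}$. Here $Sh(B)$ is the topos of sheaves of sets on $B$, regarded as a poset category with the Grothendieck topology in which a sieve on $a \in B$ covers if and only if the join of the domains of its members is $a$. A geometric morphism $f : \mathcal{F} \to \mathcal{E}$ consists of functors $f_* : \mathcal{F} \to \mathcal{E}$ and $f^* : \mathcal{E} \to \mathcal{F}$ together with an adjunction $f^* \dashv f_*$ such that $f^*$ preserves finite limits; it is surjective if $f^*$ is faithful. -/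

import Mathlib

open CategoryTheory CategoryTheory.Limits

universe w v u v₁ u₁ v₂ u₂

namespace BarrTopos

/-- A category is a Grothendieck topos (relative to the universe `w` of small sets) if it is
equivalent to the category of sheaves of small sets on a small site. -/
def IsGrothendieckTopos (E : Type u) [Category.{v} E] : Prop :=
  ∃ (C : Type w) (_ : SmallCategory C) (J : GrothendieckTopology C),
    Nonempty (E ≌ Sheaf J (Type w))

/-- A geometric morphism `F → E`: an adjunction `f^* ⊣ f_*` between the inverse image
`f^* : E ⥤ F` and the direct image `f_* : F ⥤ E`, with `f^*` preserving finite limits. -/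
structure GeometricMorphism (F : Type u₁) [Category.{v₁} F] (E : Type u₂) [Category.{v₂} E] where
  /-- the direct image functor `f_*` -/
  direct : F ⥤ E
  /-- the inverse image functor `f^*` -/
  inverse : E ⥤ F
  /-- the inverse image is left adjoint to the direct image -/
  adj : inverse ⊣ direct
  /-- the inverse image is left exact -/
  leftExact : PreservesFiniteLimits inverse

/-- A geometric morphism is surjective if its inverse image functor is faithful. -/
def GeometricMorphism.IsSurjective {F : Type u₁} [Category.{v₁} F] {E : Type u₂} [Category.{v₂} E]
    (f : GeometricMorphism F E) : Prop :=
  f.inverse.Faithful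

/-- The Grothendieck topology on a frame, regarded as a poset category: a sieve on `a` covers
if the join of the domains of its arrows is `a`. -/
def frameTopology (L : Type w) [Order.Frame L] : GrothendieckTopology L where
  sieves a := {S | sSup {b : L | ∃ g : b ⟶ a, S.arrows g} = a}
  top_mem' a := le_antisymm (sSup_le fun _ ⟨g, _⟩ => leOfHom g) (le_sSup ⟨𝟙 a, trivial⟩)
  pullback_stable' a c S f hS := by
    have hS' : sSup {b : L | ∃ g : b ⟶ a, S.arrows g} = a := hS
    refine le_antisymm (sSup_le fun _ ⟨g, _⟩ => leOfHom g) ?_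
    have hc : c = c ⊓ sSup {b : L | ∃ g : b ⟶ a, S.arrows g} := by
      rw [hS']; exact (inf_eq_left.mpr (leOfHom f)).symm
    conv_lhs => rw [hc]
    rw [inf_sSup_eq]
    refine iSup₂_le fun b hb => ?_
    obtain ⟨g, hg⟩ := hb
    exact le_sSup ⟨homOfLE inf_le_left,
      S.downward_closed hg (homOfLE (inf_le_right : c ⊓ b ≤ b))⟩
  transitive' a S hS R hR := by
    have hS' : sSup {b : L | ∃ g : b ⟶ a, S.arrows g} = a := hS
    refine le_antisymm (sSup_le fun _ ⟨g, _⟩ => leOfHom g) ?_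
    conv_lhs => rw [← hS']
    refine sSup_le fun b hb => ?_
    obtain ⟨g, hg⟩ := hb
    have hb' : sSup {c : L | ∃ h : c ⟶ b, (R.pullback g).arrows h} = b := hR hg
    conv_lhs => rw [← hb']
    exact sSup_le fun c ⟨h, hh⟩ => le_sSup ⟨h ≫ g, hh⟩

/-- The topos of sheaves of sets on a frame (equivalently, on the corresponding locale). -/
abbrev FrameSheaf (L : Type w) [Order.Frame L] : Type (w + 1) :=
  Sheaf (frameTopology L) (Type w)

end BarrTopos

/-!
Let `(C, J)` be a small site. A cocontinuous functor `G : D ⥤ C` into it induces a geometric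
morphism of sheaf topoi whose inverse image is precomposition with `G` followed by sheafification.
When `D` is thin and carries the dense topology, the comparison lemma identifies the sheaves on `D`
with the sheaves on the complete Boolean algebra of regular down-closed sets of objects of `D`
(`toRegularDownSet_isDenseSubsite`). So it suffices to find a thin `D` and a functor `G` that is
cocontinuous for the dense topology and whose inverse image is faithful.

Take for `D` the disjoint union of trees, one for each `J`-closed sieve `T` on an object `c`. The
tree of `T` consists of the strings `cₙ ⟶ ⋯ ⟶ c₁ ⟶ c` of morphisms of `C` whose composite is not in
`T`, ordered by extension at the source; `G` sends a string to `cₙ`. Passing from morphisms to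
strings is what makes `D` thin: an extension of one string to another is unique.

* If `S` covers `cₙ`, then some member of `S` extends the string without its composite falling into
  `T`, since otherwise the closed sieve `T` would contain the composite. Hence `S` pulls back to a
  dense sieve, and `G` is cocontinuous (`exists_extension`, `stringSource_isCocontinuous`).
* If `α` and `β` are morphisms of sheaves with `α x ≠ β x` for a section `x` over `c`, then the
  sieve `T` on which `α x` and `β x` agree is closed and proper. No string in the tree of `T` makes
  the two sections agree, so they stay distinct after sheafification over the empty string
  (`exists_avoiding`, `GeometricMorphism.ofIsCocontinuous_isSurjective`).
-/

namespace BarrTopos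

/-! ### Regular elements of a frame -/

/-- The regular elements of a frame form a complete Boolean algebra, the complete lattice structure
being transported along the reflection `a ↦ aᶜᶜ`. -/
instance regularCompleteBooleanAlgebra (α : Type*) [Order.Frame α] :
    CompleteBooleanAlgebra (Heyting.Regular α) where
  __ := (inferInstance : BooleanAlgebra (Heyting.Regular α))
  sSup s := Heyting.Regular.toRegular (⨆ b ∈ s, (b : α))
  sInf s := Heyting.Regular.toRegular (⨅ b ∈ s, (b : α))
  isLUB_sSup s :=
    ⟨fun b hb => Heyting.Regular.coe_le_coe.1
      ((le_iSup₂ (f := fun (b : Heyting.Regular α) (_ : b ∈ s) => (b : α)) b hb).trans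
        le_compl_compl),
    fun _ hb => (Heyting.Regular.gi.gc _ _).2 (iSup₂_le fun _ hc => hb hc)⟩
  isGLB_sInf s :=
    ⟨fun _ hb => (Heyting.Regular.gi.gc _ _).2 (iInf₂_le _ hb),
    fun _ hb => Heyting.Regular.coe_le_coe.1 <|
      (le_iInf₂ (f := fun (c : Heyting.Regular α) (_ : c ∈ s) => (c : α))
        fun _ hc => hb hc).trans le_compl_compl⟩

lemma coe_regular_sSup {α : Type*} [Order.Frame α] (s : Set (Heyting.Regular α)) :
    ((sSup s : Heyting.Regular α) : α) = (⨆ b ∈ s, (b : α))ᶜᶜ := rfl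

/-! ### Down-closed sets of objects and their regularization -/

section DownSet

variable (D : Type w) [SmallCategory D]

/-- Sets of objects of `D` that contain the source of every morphism whose target they contain. -/
abbrev DownSet : Type w := @LowerSet D ⟨fun p q => Nonempty (p ⟶ q)⟩

/-- The complete Boolean algebra of regular down-closed sets of objects of `D`. For a thin category
these are the regular open sets of the Alexandrov topology. -/
abbrev RegularDownSet : Type w := Heyting.Regular (DownSet D)

variable {D}

lemma DownSet.mem_of_hom (U : DownSet D) {p q : D} (f : p ⟶ q) (h : q ∈ U) : p ∈ U :=
  @LowerSet.lower' D ⟨fun p q => Nonempty (p ⟶ q)⟩ U _ _ ⟨f⟩ h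

/-- The down-closed set generated by an object. -/
def principal (p : D) : DownSet D :=
  @LowerSet.mk D ⟨fun p q => Nonempty (p ⟶ q)⟩ {q | Nonempty (q ⟶ p)}
    (fun _ _ ⟨f⟩ ⟨g⟩ => ⟨f ≫ g⟩)

lemma principal_le_iff {p : D} {U : DownSet D} : principal p ≤ U ↔ p ∈ U :=
  ⟨fun h => h ⟨𝟙 p⟩, fun h _ ⟨f⟩ => U.mem_of_hom f h⟩

lemma mem_compl_iff {U : DownSet D} {p : D} : p ∈ Uᶜ ↔ ∀ ⦃q : D⦄, (q ⟶ p) → q ∉ U := by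
  rw [← principal_le_iff, le_compl_iff_disjoint_right, disjoint_iff_inf_le]
  exact ⟨fun h q f hq => h (a := q) ⟨⟨f⟩, hq⟩, fun h q hq => h hq.1.some hq.2⟩

lemma mem_compl_compl_iff {U : DownSet D} {p : D} :
    p ∈ Uᶜᶜ ↔ ∀ ⦃q : D⦄, (q ⟶ p) → ∃ r : D, Nonempty (r ⟶ q) ∧ r ∈ U := by
  simp only [mem_compl_iff]
  push Not
  exact ⟨fun h q f => let ⟨r, g, hr⟩ := h f; ⟨r, ⟨g⟩, hr⟩,
    fun h q f => let ⟨r, ⟨g⟩, hr⟩ := h f; ⟨r, g, hr⟩⟩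

/-- The regular down-closed set generated by an object. -/
def regularPrincipal (p : D) : RegularDownSet D := Heyting.Regular.toRegular (principal p)

lemma regularPrincipal_le_iff {p : D} {b : RegularDownSet D} :
    regularPrincipal p ≤ b ↔ p ∈ (b : DownSet D) :=
  (Heyting.Regular.gi.gc _ _).trans principal_le_iff

lemma mem_regularPrincipal_iff {p q : D} :
    q ∈ (regularPrincipal p : DownSet D) ↔
      ∀ ⦃r : D⦄, (r ⟶ q) → ∃ s : D, Nonempty (s ⟶ r) ∧ Nonempty (s ⟶ p) :=
  mem_compl_compl_iff

lemma le_regular_sSup_iff {b : RegularDownSet D} {s : Set (RegularDownSet D)} :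
    b ≤ sSup s ↔ ∀ p ∈ (b : DownSet D), ∃ q : D, Nonempty (q ⟶ p) ∧
      ∃ c ∈ s, q ∈ (c : DownSet D) := by
  rw [← Heyting.Regular.coe_le_coe, coe_regular_sSup]
  constructor
  · intro h p hp
    obtain ⟨q, hq, hq'⟩ := mem_compl_compl_iff.1 (h hp) (𝟙 p)
    simp only [LowerSet.mem_iSup_iff] at hq'
    obtain ⟨c, hc, hq'⟩ := hq'
    exact ⟨q, hq, c, hc, hq'⟩
  · intro h p hp
    refine mem_compl_compl_iff.2 fun q f => ?_
    obtain ⟨r, hr, c, hc, hr'⟩ := h q (DownSet.mem_of_hom _ f hp)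
    refine ⟨r, hr, ?_⟩
    simp only [LowerSet.mem_iSup_iff]
    exact ⟨c, hc, hr'⟩

/-! ### The dense topology on a thin category is a site for a Boolean algebra -/

/-- The functor sending an object to the regular down-closed set it generates. -/
def toRegularDownSet : D ⥤ RegularDownSet D where
  obj := regularPrincipal
  map {_ q} f := homOfLE (regularPrincipal_le_iff.2
    (Heyting.Regular.gi.gc.le_u_l (principal q) ⟨f⟩))

/-- A sieve on a regular set `b` covers if and only if the objects `q` for which it contains the
inclusion of the set generated by `q` are dense in `b`. -/
lemma mem_frameTopology_iff {b : RegularDownSet D} {S : Sieve b} :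
    S ∈ frameTopology (RegularDownSet D) b ↔ ∀ p ∈ (b : DownSet D), ∃ q : D, Nonempty (q ⟶ p) ∧
      ∃ g : toRegularDownSet.obj q ⟶ b, S g := by
  have h : S ∈ frameTopology (RegularDownSet D) b ↔
      b ≤ sSup {c | ∃ g : c ⟶ b, S.arrows g} :=
    ⟨fun h => h.ge, fun h => le_antisymm (sSup_le fun _ ⟨g, _⟩ => leOfHom g) h⟩
  rw [h, le_regular_sSup_iff]
  refine forall₂_congr fun p hp => exists_congr fun q => and_congr_right fun _ => ?_
  constructor
  · rintro ⟨c, ⟨g, hg⟩, hq⟩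
    exact ⟨homOfLE (regularPrincipal_le_iff.2 hq) ≫ g, S.downward_closed hg _⟩
  · rintro ⟨g, hg⟩
    exact ⟨_, ⟨g, hg⟩, regularPrincipal_le_iff.1 le_rfl⟩

variable [Quiver.IsThin D]

/-- The hypothesis of the comparison lemma. The functor is in general neither full nor injective on
objects, but an inclusion between generated regular sets is induced by morphisms of `D` on a dense
set of objects. -/
instance toRegularDownSet_isDenseSubsite :
    (toRegularDownSet (D := D)).IsDenseSubsite GrothendieckTopology.dense
      (frameTopology (RegularDownSet D)) where
  isCoverDense' := ⟨fun b => mem_frameTopology_iff.2 fun p hp =>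
    ⟨p, ⟨𝟙 p⟩, homOfLE (regularPrincipal_le_iff.2 hp), Presieve.in_coverByImage _ _⟩⟩
  isLocallyFull' := ⟨fun {p q} f => mem_frameTopology_iff.2 fun a ha => by
    obtain ⟨r, ⟨g⟩, ⟨h⟩⟩ := mem_regularPrincipal_iff.1 ha (𝟙 a)
    have hr : r ∈ (regularPrincipal q : DownSet D) :=
      regularPrincipal_le_iff.1 (leOfHom (toRegularDownSet.map h ≫ f))
    obtain ⟨s, ⟨k⟩, ⟨l⟩⟩ := mem_regularPrincipal_iff.1 hr (𝟙 r)
    exact ⟨s, ⟨k ≫ g⟩, toRegularDownSet.map (k ≫ h),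
      s, k ≫ h, 𝟙 _, ⟨l, Subsingleton.elim _ _⟩, Subsingleton.elim _ _⟩⟩
  isLocallyFaithful' := ⟨fun {p q} f₁ f₂ _ => by
    obtain rfl : f₁ = f₂ := Subsingleton.elim _ _
    rw [Sieve.equalizer_self, Sieve.functorPushforward_top]
    exact GrothendieckTopology.top_mem _ _⟩
  functorPushforward_mem_iff {p S} := by
    rw [mem_frameTopology_iff]
    constructor
    · intro h q f
      have hq : q ∈ (regularPrincipal p : DownSet D) :=
        regularPrincipal_le_iff.1 (leOfHom (toRegularDownSet.map f))
      obtain ⟨r, ⟨g⟩, -, t, k, l, hk, -⟩ := h q hq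
      obtain ⟨s, ⟨m⟩, ⟨n⟩⟩ :=
        mem_regularPrincipal_iff.1 (regularPrincipal_le_iff.1 (leOfHom l)) (𝟙 r)
      refine ⟨s, m ≫ g, ?_⟩
      rw [Subsingleton.elim ((m ≫ g) ≫ f) (n ≫ k)]
      exact S.downward_closed hk n
    · intro h a ha
      obtain ⟨r, ⟨g⟩, ⟨k⟩⟩ := mem_regularPrincipal_iff.1 ha (𝟙 a)
      obtain ⟨s, l, hl⟩ := h k
      exact ⟨s, ⟨l ≫ g⟩, toRegularDownSet.map (l ≫ k), s, l ≫ k, 𝟙 _, hl, Subsingleton.elim _ _⟩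

end DownSet

/-! ### Geometric morphisms from cocontinuous functors -/

section Cocontinuous

variable {C D : Type w} [SmallCategory C] [SmallCategory D]
  (J : GrothendieckTopology C) (K : GrothendieckTopology D) (G : D ⥤ C) [G.IsCocontinuous K J]

/-- The geometric morphism `Sh(D, K) → Sh(C, J)` induced by a cocontinuous functor `G : D ⥤ C`. Its
inverse image sends a sheaf `F` to the sheafification of `G.op ⋙ F`, its direct image is right Kan
extension along `G.op`. -/
noncomputable def GeometricMorphism.ofIsCocontinuous :
    GeometricMorphism (Sheaf K (Type w)) (Sheaf J (Type w)) where
  direct := G.sheafPushforwardCocontinuous (Type w) K J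
  inverse := sheafToPresheaf J (Type w) ⋙ (Functor.whiskeringLeft _ _ (Type w)).obj G.op ⋙
    presheafToSheaf K (Type w)
  adj := ((G.op.ranAdjunction (Type w)).comp
    (sheafificationAdjunction K (Type w))).restrictFullyFaithful
      (fullyFaithfulSheafToPresheaf J (Type w)) (Functor.FullyFaithful.id _)
      (Iso.refl _) (Iso.refl _)
  leftExact := inferInstance

/-- The functor `G` induces a surjective geometric morphism as soon as, for every proper closed
sieve `T` on `c`, there is `e : G.obj p ⟶ c` such that no covering sieve of `p` is mapped into `T`
by `h ↦ G.map h ≫ e`. Namely, the equalizer sieve of two distinct sections of a sheaf is closed and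
proper, and the condition keeps their restrictions along `e` apart in the sheafification. -/
lemma GeometricMorphism.ofIsCocontinuous_isSurjective
    (hG : ∀ (c : C) (T : Sieve c), J.IsClosed T → T ≠ ⊤ →
      ∃ (p : D) (e : G.obj p ⟶ c), ∀ R ∈ K p, ∃ (q : D) (h : q ⟶ p),
        R h ∧ ¬ T (G.map h ≫ e)) :
    (ofIsCocontinuous J K G).IsSurjective where
  map_injective {F F'} α β hαβ := by
    have hαβ : (presheafToSheaf K (Type w)).map (Functor.whiskerLeft G.op α.hom) =
      (presheafToSheaf K (Type w)).map (Functor.whiskerLeft G.op β.hom) := hαβ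
    have hsep : Presieve.IsSeparated J F'.obj :=
      ((isSheaf_iff_isSheaf_of_type J F'.obj).1 F'.property).isSeparated
    ext ⟨c⟩ x
    by_contra hne
    let T : Sieve c := Presheaf.equalizerSieve (F := F'.obj) (X := .op c)
      (α.hom.app _ x) (β.hom.app _ x)
    have hT : J.IsClosed T := fun d f hf => (hsep _ hf).ext fun a g hg => by
      have hg : F'.obj.map (g ≫ f).op _ = F'.obj.map (g ≫ f).op _ := hg
      simpa using hg
    have hT' : T ≠ ⊤ := fun h => hne <| by
      have h' : F'.obj.map (𝟙 c).op _ = F'.obj.map (𝟙 c).op _ :=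
        show T (𝟙 c) from h ▸ trivial
      simpa using h'
    obtain ⟨p, e, he⟩ := hG c T hT hT'
    -- The two sections over `p` become equal in the sheafification, hence agree on a covering sieve.
    have hη : Functor.whiskerLeft G.op α.hom ≫ toSheafify K (G.op ⋙ F'.obj) =
        Functor.whiskerLeft G.op β.hom ≫ toSheafify K (G.op ⋙ F'.obj) := by
      rw [toSheafify_naturality, toSheafify_naturality]
      exact congrArg (_ ≫ ·) (congrArg (sheafToPresheaf K (Type w)).map hαβ)
    have hR := Presheaf.equalizerSieve_mem K (toSheafify K (G.op ⋙ F'.obj)) (X := .op p)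
      (α.hom.app _ (F.obj.map e.op x)) (β.hom.app _ (F.obj.map e.op x))
      (ConcreteCategory.congr_hom (NatTrans.congr_app hη (.op p)) (F.obj.map e.op x))
    obtain ⟨q, h, hq, hq'⟩ := he _ hR
    refine hq' ?_
    have hq : F'.obj.map (G.map h).op _ = F'.obj.map (G.map h).op _ := hq
    change F'.obj.map (G.map h ≫ e).op _ = F'.obj.map (G.map h ≫ e).op _
    simpa [NatTrans.naturality_apply] using hq

end Cocontinuous

/-! ### Composition with equivalences -/

section Equivalence

variable {E : Type u} [Category.{v} E] {F : Type u₁} [Category.{v₁} F]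

/-- The geometric morphism given by an equivalence. -/
noncomputable def GeometricMorphism.ofEquivalence (e : E ≌ F) : GeometricMorphism E F where
  direct := e.functor
  inverse := e.inverse
  adj := e.symm.toAdjunction
  leftExact := inferInstance

/-- Composition of geometric morphisms. -/
noncomputable def GeometricMorphism.comp {H : Type u₂} [Category.{v₂} H]
    (f : GeometricMorphism E F) (g : GeometricMorphism F H) : GeometricMorphism E H where
  direct := f.direct ⋙ g.direct
  inverse := g.inverse ⋙ f.inverse
  adj := g.adj.comp f.adj
  leftExact := by
    have := f.leftExact
    have := g.leftExact
    infer_instance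

lemma GeometricMorphism.ofEquivalence_isSurjective (e : E ≌ F) :
    (ofEquivalence e).IsSurjective :=
  inferInstanceAs e.inverse.Faithful

lemma GeometricMorphism.IsSurjective.comp {H : Type u₂} [Category.{v₂} H]
    {f : GeometricMorphism E F} {g : GeometricMorphism F H}
    (hf : f.IsSurjective) (hg : g.IsSurjective) : (f.comp g).IsSurjective := by
  have : f.inverse.Faithful := hf
  have : g.inverse.Faithful := hg
  exact inferInstanceAs (g.inverse ⋙ f.inverse).Faithful

end Equivalence

/-! ### The forest of strings avoiding a closed sieve -/

section Strings

variable {C : Type w} [SmallCategory C] (J : GrothendieckTopology C)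

/-- Path categories are right cancellative, so their slices are thin. -/
instance (X : Paths C) : Quiver.IsThin (Over X) := fun a b => ⟨fun f g => by
  ext
  exact Quiver.Path.comp_injective_left b.hom ((Over.w f).trans (Over.w g).symm)⟩

/-- A closed sieve of a site, together with the object it lives on. -/
structure ClosedSieve where
  /-- the object on which the sieve lives -/
  root : C
  /-- the underlying sieve -/
  sieve : Sieve root
  isClosed : J.IsClosed sieve

variable {J}

/-- The tree of strings `cₙ ⟶ ⋯ ⟶ c₁ ⟶ c₀` of morphisms whose target `c₀` is the object carrying
the closed sieve `T` and whose composite does not belong to `T`. A morphism to a string is an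
extension of it at the source. -/
abbrev StringTree (T : ClosedSieve J) : Type w :=
  ObjectProperty.FullSubcategory fun p : Over ((Paths.of C).obj T.root) =>
    ¬ T.sieve (composePath p.hom)

variable (J)

/-- The disjoint union, over all closed sieves, of the trees of strings avoiding the sieve. -/
abbrev StringForest : Type w := Σ T : ClosedSieve J, StringTree T

instance (T : ClosedSieve J) : Quiver.IsThin (StringTree T) := fun _ _ =>
  ⟨fun _ _ => (ObjectProperty.ι _).map_injective (Subsingleton.elim _ _)⟩

instance : Quiver.IsThin (StringForest J) := by
  rintro ⟨T, p⟩ _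
  constructor
  rintro ⟨f⟩ g
  obtain ⟨g, rfl⟩ := (Sigma.incl T).map_surjective g
  exact congrArg Sigma.SigmaHom.mk (Subsingleton.elim f g)

/-- The functor sending a string to the source of its composite. -/
def stringSource : StringForest J ⥤ C :=
  Sigma.desc fun _ => ObjectProperty.ι _ ⋙ Over.forget _ ⋙ pathComposition C

/-- A covering sieve of the source of a string avoiding `T` contains a morphism by which the string
can be extended without entering `T`, because `T` is closed. -/
lemma exists_extension {p : StringForest J} {S : Sieve ((stringSource J).obj p)}
    (hS : S ∈ J _) : ∃ (q : StringForest J) (f : q ⟶ p), S ((stringSource J).map f) := by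
  obtain ⟨T, ⟨p, hp⟩⟩ := p
  have : ∃ (d : C) (g : d ⟶ p.left), S g ∧ ¬ T.sieve (g ≫ composePath p.hom) := by
    by_contra! h
    exact hp (T.isClosed _ (J.superset_covering (fun d g hg => h d g hg) hS))
  obtain ⟨d, g, hg, hgT⟩ := this
  let q : Over ((Paths.of C).obj T.root) := Over.mk ((Paths.of C).map g ≫ p.hom)
  let f : q ⟶ p := Over.homMk ((Paths.of C).map g)
  refine ⟨⟨T, ⟨q, ?_⟩⟩, Sigma.SigmaHom.mk ⟨f⟩, ?_⟩
  · have h : composePath ((Paths.of C).map g ≫ p.hom) = g ≫ composePath p.hom :=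
      (composePath_comp g.toPath p.hom).trans (congrArg (· ≫ _) (composePath_toPath g))
    exact Eq.subst (motive := fun k : d ⟶ T.root => ¬ T.sieve k) h.symm hgT
  · exact Eq.subst (motive := fun k : d ⟶ p.left => S k) (composePath_toPath g).symm hg

instance stringSource_isCocontinuous :
    (stringSource J).IsCocontinuous GrothendieckTopology.dense J where
  cover_lift {p S} hS q f := by
    obtain ⟨r, g, hg⟩ := exists_extension J (J.pullback_stable ((stringSource J).map f) hS)
    exact ⟨r, g, Eq.subst (motive := fun k => S k) ((stringSource J).map_comp g f).symm hg⟩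

/-- No extension of the empty string over the domain of a proper closed sieve `T` has its composite
in `T`, so the tree of `T` keeps apart any two sections with equalizer sieve `T`. -/
lemma exists_avoiding (c : C) (T : Sieve c) (hT : J.IsClosed T) (hT' : T ≠ ⊤) :
    ∃ (p : StringForest J) (e : (stringSource J).obj p ⟶ c),
      ∀ R ∈ GrothendieckTopology.dense p, ∃ (q : StringForest J) (h : q ⟶ p),
        R h ∧ ¬ T ((stringSource J).map h ≫ e) := by
  -- The empty string at `c`.
  let p : StringTree (J := J) ⟨c, T, hT⟩ :=
    ⟨Over.mk (𝟙 ((Paths.of C).obj c)), fun h => hT' (T.id_mem_iff_eq_top.1 h)⟩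
  refine ⟨⟨_, p⟩, 𝟙 c, fun R hR => ?_⟩
  obtain ⟨q, h, hq⟩ := hR (𝟙 _)
  refine ⟨q, h, Eq.subst (motive := fun k => R k) (Category.comp_id h) hq, ?_⟩
  obtain @⟨_, q, _, h⟩ := h
  have hw : (pathComposition C).map q.obj.hom = (pathComposition C).map h.hom.left ≫ 𝟙 c :=
    (congrArg (pathComposition C).map ((Over.w h.hom).symm.trans (Category.comp_id _))).trans
      (Category.comp_id ((pathComposition C).map h.hom.left)).symm
  exact (congrArg (fun k : (pathComposition C).obj q.obj.left ⟶ c => ¬ T k) hw).mp q.property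

end Strings

end BarrTopos

/-- Every Grothendieck topos `E` admits a surjective geometric morphism `Sh(B) → E` from the topos
of sheaves on a (small) complete Boolean algebra `B`. -/
theorem mainTheorem2 (E : Type u) [Category.{v} E]
    (hE : BarrTopos.IsGrothendieckTopos.{w} E) :
    ∃ (B : Type w) (_ : CompleteBooleanAlgebra B)
      (f : BarrTopos.GeometricMorphism (BarrTopos.FrameSheaf B) E),
      f.IsSurjective := by
  obtain ⟨C, _, J, ⟨e⟩⟩ := hE
  let e' : BarrTopos.FrameSheaf (BarrTopos.RegularDownSet (BarrTopos.StringForest J)) ≌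
      Sheaf (GrothendieckTopology.dense (C := BarrTopos.StringForest J)) (Type w) :=
    (Functor.IsDenseSubsite.sheafEquiv _ _ BarrTopos.toRegularDownSet (Type w)).symm
  exact ⟨BarrTopos.RegularDownSet (BarrTopos.StringForest J), inferInstance, _,
    ((BarrTopos.GeometricMorphism.ofEquivalence_isSurjective e').comp
      (BarrTopos.GeometricMorphism.ofIsCocontinuous_isSurjective J _ (BarrTopos.stringSource J)
        (BarrTopos.exists_avoiding J))).comp
      (BarrTopos.GeometricMorphism.ofEquivalence_isSurjective e.symm)⟩
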